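/- Let $n\ge 9$ and $T\ge 0$ be integers and $\vartheta\in(0,1]$. Let $V_{-n},\dots,V_T$ be i.i.d. real random variables (scores) whose common c.d.f. $F$ is continuous. For $0\le t\le T$ let $\mathcal H_t=\{-n,\dots,t-1\}$, and let $\mathcal A_t:\mathbb R^{\mathcal H_t}\to\mathbb R$ return the $\vartheta$-th sample quantile of its arguments, that is, the $\lceil\vartheta(n+t)\rceil$-th smallest of them. For identically distributed scores $Z_{-n},\dots,Z_T$ and a further variable $Z'$, define the swap sensitivities $$\sigma_t=\max_{s\in\mathcal H_t}\mathbb E\Big[\big|\mathcal A_t(\{Z_i\}_{i\in\mathcal H_t})-\mathcal A_t(\{Z_i\}_{i\in\mathcal H_t,\,i\ne s},Z')\big|\;\Big|\;\{Z_i\}_{i\in\mathcal H_t,\,i\neq s}\Big],$$ where in the second term $Z'$ takes the place of $Z_s$ (each $\sigma_t$ is a random variable), let $\rho$ be the essential supremum of the Lebesgue density of $Z_i$, and set $$\epsilon(T)=2\sum_{j=0}^{T-1}\sigma_j+3(\sqrt{e\rho}+1)\log(T+n)+\tfrac12 .$$ Take here the normalized scores $Z_i=F(V_i)$ and $Z'=F(V)$,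 where $V$ is a copy of the scores (same law) independent of $(V_{-n},\dots,V_T)$. Then: 1. Almost surely, for all $0\le t\le T$, the normalized scores give the same selection decisions as the original ones: $\mathbf 1\{Z_t\le\mathcal A_t(\{Z_i\}_{i\in\mathcal H_t})\}=\mathbf 1\{V_t\le\mathcal A_t(\{V_i\}_{i\in\mathcal H_t})\}$. 2. With probability at least $1-(T+n)^{-2}$, $$\epsilon(T)\le 36\log^2(T+n).$$ -/

import Mathlib

open MeasureTheory ProbabilityTheory

noncomputable section

namespace CAP

/-- The holdout set `H_t = {-n, …, t - 1}` available at time `t`. -/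
def holdout (n t : ℕ) : Finset ℤ := Finset.Ico (-(n : ℤ)) (t : ℤ)

/-- The `r`-th smallest of the finitely many values `v i` (for `1 ≤ r ≤ #ι`): the least `x` such
that at least `r` of the values are `≤ x`. -/
def orderStat {ι : Type*} [Fintype ι] (v : ι → ℝ) (r : ℕ) : ℝ :=
  sInf {x : ℝ | r ≤ Nat.card {i : ι // v i ≤ x}}

/-- The `ϑ`-th sample quantile of the values `v i`: their `⌈ϑ m⌉`-th smallest, where `m = #ι`. -/
def sampleQuantile {ι : Type*} [Fintype ι] (ϑ : ℝ) (v : ι → ℝ) : ℝ :=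
  orderStat v ⌈ϑ * (Fintype.card ι : ℝ)⌉₊

/-- A sequence of threshold functions `A_t : ℝ^{H_t} → ℝ`. -/
abbrev Threshold (n : ℕ) : Type := (t : ℕ) → (holdout n t → ℝ) → ℝ

/-- The threshold functions that return the `ϑ`-th sample quantile of the historical scores. -/
def quantileThreshold (n : ℕ) (ϑ : ℝ) : Threshold n := fun _ v => sampleQuantile ϑ v

/-- The historical scores `{Z_i}_{i ∈ H_t}` at the outcome `ω`. -/
def history {Ω : Type*} (n : ℕ) (Z : ℤ → Ω → ℝ) (t : ℕ) (ω : Ω) : holdout n t → ℝ :=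
  fun i => Z i ω

open Classical in
/-- The selection decision `S_t = 1{Z_t ≤ A_t({Z_i}_{i ∈ H_t})}`. -/
def decision {Ω : Type*} {n : ℕ} (A : Threshold n) (Z : ℤ → Ω → ℝ) (t : ℕ) (ω : Ω) : ℕ :=
  if Z t ω ≤ A t (history n Z t ω) then 1 else 0

/-- The σ-algebra generated by the historical scores other than `Z_s`. -/
abbrev sigmaOthers {Ω : Type*} {n : ℕ} (Z : ℤ → Ω → ℝ) (t : ℕ) (s : holdout n t) :
    MeasurableSpace Ω :=
  ⨆ i : {i : holdout n t // i ≠ s}, MeasurableSpace.comap (Z i) inferInstance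

/-- The smallest `σ_t` allowed by the swap-stability condition:
`max_{s ∈ H_t} E[ |A_t({Z_i}_{i ∈ H_t}) - A_t({Z_i}_{i ∈ H_t, i ≠ s}, Z')| | {Z_i}_{i ∈ H_t, i ≠ s} ]`,
where `Z'` is to be an independent copy of the scores. It is a random variable. -/
def swapSensitivity {Ω : Type*} [MeasurableSpace Ω] {n : ℕ} (μ : Measure Ω) (A : Threshold n)
    (Z : ℤ → Ω → ℝ) (Z' : Ω → ℝ) (t : ℕ) (ω : Ω) : ℝ :=
  ⨆ s : holdout n t,
    (μ[fun ω' => |A t (history n Z t ω') - A t (Function.update (history n Z t ω') s (Z' ω'))| |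
      sigmaOthers Z t s]) ω

/-- The smallest upper bound `ρ` of the Lebesgue density of the law of a real random variable. -/
def densityBound {Ω : Type*} [MeasurableSpace Ω] (μ : Measure Ω) (X : Ω → ℝ) : ℝ :=
  (essSup (pdf X μ volume) volume).toReal

/-- The error `ε(T) = 2 ∑_{j=0}^{T-1} σ_j + 3 (√(e ρ) + 1) log (T + n) + 1/2` for identically
distributed scores `Z_i`. -/
def errorTerm {Ω : Type*} [MeasurableSpace Ω] {n : ℕ} (μ : Measure Ω) (A : Threshold n)
    (Z : ℤ → Ω → ℝ) (Z' : Ω → ℝ) (T : ℕ) (ω : Ω) : ℝ :=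
  2 * ∑ j ∈ Finset.range T, swapSensitivity μ A Z Z' j ω +
    3 * (√(Real.exp 1 * densityBound μ (Z 0)) + 1) * Real.log ((T : ℝ) + (n : ℝ)) + 2⁻¹

end CAP

end

/-! Since y ≤ (r-th smallest) means that fewer than r values lie strictly below y, a decision
depends only on which historical scores are strictly below the current one. A monotone `F` preserves
this unless it creates ties, and independent uniform scores almost surely have none
(`decision_comp_eq`, `ae_ne_of_indepFun`).

For the error, continuity of `F` makes the normalized scores uniform on [0,1], so ρ ≤ 1. Changing
one coordinate cannot move an order statistic past another sample point (`notMem_Ioo_orderStat`), so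
the move is controlled by gaps in the sample. Put N = T + n and use a grid of mesh h_t = 4 log N /
(t + n): by independence and a union bound, all cells are occupied at all times t < T except with
probability N⁻². On that event the sensitivity is at most 3 h_t, almost surely
(`swapSensitivity_le`), and the harmonic sum of the h_t gives order log² N. -/

namespace CAP

/-! ### Order statistics and their stability under one swap -/

/-- A number is at most the `r`-th smallest value iff fewer than `r` values lie strictly below. -/
theorem le_orderStat_iff {ι : Type*} [Fintype ι] (v : ι → ℝ) {r : ℕ} (hr : 1 ≤ r)
    (hr' : r ≤ Fintype.card ι) (y : ℝ) :
    y ≤ orderStat v r ↔ Nat.card {i : ι // v i < y} < r := by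
  classical
  set S : Set ℝ := {x : ℝ | r ≤ Nat.card {i : ι // v i ≤ x}} 
  have hι : Nonempty ι := Fintype.card_pos_iff.1 (hr.trans hr')
  have hne : S.Nonempty := by
    obtain ⟨i₀, hi₀⟩ := Finite.exists_max v
    refine ⟨v i₀, hr'.trans (le_of_eq ?_)⟩
    have h : Nat.card {i : ι // v i ≤ v i₀} = Nat.card ι :=
      Nat.card_congr (Equiv.subtypeUnivEquiv hi₀)
    rw [← Nat.card_eq_fintype_card, ← h]
  have hmin : ∀ x ∈ S, ∃ i, v i ≤ x := by
    intro x hx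
    by_contra! h
    have : Nat.card {i : ι // v i ≤ x} = 0 := by
      have : IsEmpty {i : ι // v i ≤ x} := ⟨fun i => absurd i.2 (not_le.2 (h i))⟩
      exact Nat.card_of_isEmpty
    have hx' : r ≤ Nat.card {i : ι // v i ≤ x} := hx
    omega
  have hbdd : BddBelow S := by
    obtain ⟨i₀, hi₀⟩ := Finite.exists_min v
    exact ⟨v i₀, fun x hx => (hmin x hx).elim fun i hi => (hi₀ i).trans hi⟩
  have hlift : orderStat v r = sInf S := rfl
  rw [hlift]
  constructor
  · intro hy
    by_contra! hlt
    have hne' : Nonempty {i : ι // v i < y} := by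
      by_contra h
      rw [not_nonempty_iff] at h
      rw [Nat.card_of_isEmpty] at hlt
      omega
    -- The largest value below `y` already has `r` values at or below it, so the infimum would be
    -- less than `y`.
    obtain ⟨i₀, hi₀⟩ := Finite.exists_max fun i : {i : ι // v i < y} => v i
    have hmem : v i₀ ∈ S := by
      refine hlt.trans ?_
      exact Nat.card_le_card_of_injective (fun i => ⟨i.1, hi₀ i⟩)
        fun i j hij => Subtype.ext (by simpa using hij)
    exact absurd i₀.2 (not_lt.2 (hy.trans (csInf_le hbdd hmem)))
  · intro hlt
    refine le_csInf hne fun x hx => ?_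
    by_contra! hxy
    have : Nat.card {i : ι // v i ≤ x} ≤ Nat.card {i : ι // v i < y} :=
      Nat.card_le_card_of_injective (fun i => ⟨i.1, i.2.trans_lt hxy⟩)
        fun i j hij => Subtype.ext (by simpa using hij)
    have hx' : r ≤ Nat.card {i : ι // v i ≤ x} := hx
    omega

/-- If two samples differ only in the coordinate `s`, then no other coordinate lies strictly
between their order statistics. -/
theorem notMem_Ioo_orderStat {ι : Type*} [Fintype ι] {v w : ι → ℝ} {r : ℕ} (hr : 1 ≤ r)
    (hr' : r ≤ Fintype.card ι) {s : ι} (hvw : ∀ i, i ≠ s → v i = w i) {i : ι} (hi : i ≠ s) :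
    v i ∉ Set.Ioo (orderStat v r) (orderStat w r) := by
  classical
  rintro ⟨h1, h2⟩
  have h3 : r ≤ Nat.card {j : ι // v j < v i} :=
    not_lt.1 fun h => absurd ((le_orderStat_iff v hr hr' _).2 h) (not_le.2 h1)
  have h4 := (le_orderStat_iff w hr hr' _).1 le_rfl
  -- Inject by fixing every index except `s`, which goes to `i`; the slot `i` is free because `v i <
  -- v i` fails.
  have h5 : Nat.card {j : ι // v j < v i} ≤ Nat.card {j : ι // w j < orderStat w r} := by
    refine Nat.card_le_card_of_injective
      (fun j => if hj : j.1 = s then ⟨i, (hvw i hi).symm.trans_lt h2⟩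
        else ⟨j.1, (hvw j.1 hj).symm.trans_lt (j.2.trans h2)⟩) fun j k hjk => ?_
    have hj2 := j.2
    have hk2 := k.2
    apply Subtype.ext
    by_cases hj : j.1 = s <;> by_cases hk : k.1 = s <;>
      simp only [hj, hk, dite_true, dite_false, Subtype.mk.injEq] at hjk ⊢
    · exact absurd (congrArg v hjk.symm) hk2.ne
    · exact absurd (congrArg v hjk) hj2.ne
    · exact hjk
  omega

theorem orderStat_mem_Icc {ι : Type*} [Fintype ι] {v : ι → ℝ} {r : ℕ} (hr : 1 ≤ r)
    (hr' : r ≤ Fintype.card ι) {a b : ℝ} (hv : ∀ i, v i ∈ Set.Icc a b) :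
    orderStat v r ∈ Set.Icc a b := by
  constructor
  · rw [le_orderStat_iff v hr hr']
    have : IsEmpty {i : ι // v i < a} := ⟨fun i => absurd i.2 (not_lt.2 (hv i.1).1)⟩
    rw [Nat.card_of_isEmpty]
    omega
  · by_contra! h
    obtain ⟨c, hbc, hc⟩ := exists_between h
    have h1 := (le_orderStat_iff v hr hr' c).1 hc.le
    rw [Nat.card_congr (Equiv.subtypeUnivEquiv fun i => (hv i).2.trans_lt hbc),
      Nat.card_eq_fintype_card] at h1
    omega

/-- If the coordinates other than `s` meet any two adjacent cells of a grid of mesh `h` of `[0,1]`,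
then order statistics move by at most `3 h` when the coordinate `s` changes. -/
theorem abs_orderStat_sub_le {ι : Type*} [Fintype ι] {v w : ι → ℝ} {r : ℕ} (hr : 1 ≤ r)
    (hr' : r ≤ Fintype.card ι) {s : ι} (hvw : ∀ i, i ≠ s → v i = w i)
    (hv : ∀ i, v i ∈ Set.Icc (0 : ℝ) 1) (hw : ∀ i, w i ∈ Set.Icc (0 : ℝ) 1) {h : ℝ} (hh : 0 < h)
    (hgrid : ∀ j : ℕ, j + 1 < ⌊1 / h⌋₊ →
      ∃ i, i ≠ s ∧ v i ∈ Set.Ico ((j : ℝ) * h) (((j : ℝ) + 2) * h)) :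
    |orderStat v r - orderStat w r| ≤ 3 * h := by
  have key : ∀ x y : ℝ, 0 ≤ x → y ≤ 1 → x + 3 * h < y → ∃ i, i ≠ s ∧ v i ∈ Set.Ioo x y := by
    intro x y hx hy hxy
    have hf := Nat.floor_le (div_nonneg hx hh.le)
    have hf' := Nat.lt_floor_add_one (x / h)
    set q := ⌊x / h⌋₊
    rw [le_div_iff₀ hh] at hf
    rw [div_lt_iff₀ hh] at hf'
    -- Cells `q + 1` and `q + 2` fit in `(x, y)`: rounding `x` up to the grid costs at most one mesh
    -- and the pair takes two, whence the factor 3.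
    obtain ⟨i, his, hi1, hi2⟩ := hgrid (q + 1) <| by
      refine Nat.lt_of_succ_le (Nat.le_floor ?_)
      rw [le_div_iff₀ hh]
      push_cast
      nlinarith
    refine ⟨i, his, ?_, ?_⟩
    · push_cast at hi1
      linarith
    · push_cast at hi2
      nlinarith
  have mv := orderStat_mem_Icc hr hr' hv
  have mw := orderStat_mem_Icc hr hr' hw
  rw [abs_le]
  constructor <;> by_contra! hlt
  · obtain ⟨i, his, hi⟩ := key _ _ mv.1 mw.2 (by linarith)
    exact notMem_Ioo_orderStat hr hr' hvw his hi
  · obtain ⟨i, his, hi⟩ := key _ _ mw.1 mv.2 (by linarith)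
    rw [hvw i his] at hi
    exact notMem_Ioo_orderStat hr hr' (fun i hi => (hvw i hi).symm) his hi

theorem one_le_ceil_mul_card {ϑ : ℝ} (hϑ : ϑ ∈ Set.Ioc (0 : ℝ) 1) {m : ℕ} (hm : 1 ≤ m) :
    1 ≤ ⌈ϑ * (m : ℝ)⌉₊ ∧ ⌈ϑ * (m : ℝ)⌉₊ ≤ m := by
  have hm' : (1 : ℝ) ≤ m := by exact_mod_cast hm
  refine ⟨Nat.one_le_ceil_iff.2 (mul_pos hϑ.1 (by linarith)), Nat.ceil_le.2 ?_⟩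
  nlinarith [hϑ.2]

/-! ### Uniformity of the normalized scores -/

/-- The probability integral transform. -/
theorem map_cdf_eq_restrict (ν : Measure ℝ) [IsProbabilityMeasure ν] (hcont : Continuous (cdf ν)) :
    ν.map (cdf ν) = volume.restrict (Set.Icc (0 : ℝ) 1) := by
  have : IsProbabilityMeasure (ν.map (cdf ν)) :=
    Measure.isProbabilityMeasure_map hcont.measurable.aemeasurable
  -- Only interior levels: 0 and 1 need not be attained.
  have hsurj : ∀ b ∈ Set.Ioo (0 : ℝ) 1, ∃ y, cdf ν y = b := fun b hb =>
    mem_range_of_exists_le_of_exists_ge hcont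
      (((tendsto_cdf_atBot ν).eventually_le_const hb.1).exists)
      (((tendsto_cdf_atTop ν).eventually_const_le hb.2).exists)
  refine Measure.ext_of_Iic _ _ fun a => ?_
  rw [Measure.map_apply hcont.measurable measurableSet_Iic,
    Measure.restrict_apply measurableSet_Iic]
  rcases lt_or_ge a 0 with ha | ha
  · have h1 : cdf ν ⁻¹' Set.Iic a = ∅ :=
      Set.eq_empty_of_forall_notMem fun y hy => absurd (cdf_nonneg ν y) (not_le.2 (hy.trans_lt ha))
    have h2 : Set.Iic a ∩ Set.Icc (0 : ℝ) 1 = ∅ :=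
      Set.eq_empty_of_forall_notMem fun y hy => absurd (hy.2.1.trans hy.1) (not_le.2 ha)
    rw [h1, h2, measure_empty, measure_empty]
  rcases le_or_gt 1 a with ha' | ha'
  · have h1 : cdf ν ⁻¹' Set.Iic a = Set.univ :=
      Set.eq_univ_of_forall fun y => (cdf_le_one ν y).trans ha'
    have h2 : Set.Iic a ∩ Set.Icc (0 : ℝ) 1 = Set.Icc 0 1 :=
      Set.inter_eq_right.2 fun y hy => hy.2.trans ha'
    rw [h1, h2, measure_univ, Real.volume_Icc, sub_zero, ENNReal.ofReal_one]
  have h2 : Set.Iic a ∩ Set.Icc (0 : ℝ) 1 = Set.Icc 0 a := by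
    ext y
    exact ⟨fun hy => ⟨hy.2.1, hy.1⟩, fun hy => ⟨hy.2, hy.1, hy.2.trans ha'.le⟩⟩
  rw [h2, Real.volume_Icc, sub_zero]
  apply le_antisymm
  · rw [← ofReal_measureReal]
    apply ENNReal.ofReal_le_ofReal
    -- The c.d.f. may be flat at level `a`; a level `b` slightly above `a` is attained at some `y`
    -- beyond the whole set `{cdf ≤ a}`.
    refine le_of_forall_gt_imp_ge_of_dense fun c hc => ?_
    obtain ⟨b, hab, hb⟩ := exists_between (lt_min hc ha')
    obtain ⟨y, hy⟩ := hsurj b ⟨ha.trans_lt hab, hb.trans_le (min_le_right _ _)⟩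
    calc ν.real (cdf ν ⁻¹' Set.Iic a) ≤ ν.real (Set.Iic y) := by
          refine measureReal_mono fun z hz => ?_
          by_contra hzy
          have h3 : cdf ν z ≤ a := hz
          have h4 := monotone_cdf ν (not_le.1 hzy).le
          linarith
      _ = b := by rw [← cdf_eq_real, hy]
      _ ≤ c := (hb.trans_le (min_le_left _ _)).le
  · rcases ha.eq_or_lt with rfl | ha
    · simp
    obtain ⟨y, hy⟩ := hsurj a ⟨ha, ha'⟩
    rw [← hy, ofReal_cdf]
    exact measure_mono fun z hz => monotone_cdf ν hz

/-! ### Measurability, invariance of decisions, harmonic sums -/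

theorem measurable_orderStat {ι : Type*} [Fintype ι] {r : ℕ} (hr : 1 ≤ r)
    (hr' : r ≤ Fintype.card ι) : Measurable fun v : ι → ℝ => orderStat v r := by
  classical
  refine measurable_of_Ici fun y => ?_
  have h1 : (fun v : ι → ℝ => orderStat v r) ⁻¹' Set.Ici y =
      (fun v : ι → ℝ => ∑ i, if v i < y then 1 else 0) ⁻¹' Set.Iio r := by
    ext v
    simp only [Set.mem_preimage, Set.mem_Ici, Set.mem_Iio, le_orderStat_iff v hr hr',
      Nat.card_eq_fintype_card, Fintype.card_subtype, Finset.card_filter]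
  rw [h1]
  refine Finset.measurable_sum _ (fun i _ => ?_) measurableSet_Iio
  exact Measurable.ite (measurableSet_lt (measurable_pi_apply i) measurable_const)
    measurable_const measurable_const

theorem card_holdout (n t : ℕ) : Fintype.card (holdout n t) = t + n := by
  rw [Fintype.card_coe, holdout, Int.card_Ico]
  omega

/-- A monotone transformation of the scores which creates no tie between the current score and a
historical one does not change the selection decision. -/
theorem decision_comp_eq {Ω : Type*} {n t : ℕ} (hn : 1 ≤ n) {ϑ : ℝ} (hϑ : ϑ ∈ Set.Ioc (0 : ℝ) 1) {F : ℝ → ℝ}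
    (hF : Monotone F) {V : ℤ → Ω → ℝ} {ω : Ω}
    (hne : ∀ i : holdout n t, F (V i ω) ≠ F (V t ω)) :
    decision (quantileThreshold n ϑ) (fun i ω => F (V i ω)) t ω =
      decision (quantileThreshold n ϑ) V t ω := by
  have hcard : 1 ≤ Fintype.card (holdout n t) := by rw [card_holdout]; omega
  obtain ⟨hr, hr'⟩ := one_le_ceil_mul_card hϑ hcard
  have hiff : F (V t ω) ≤ quantileThreshold n ϑ t (history n (fun i ω => F (V i ω)) t ω) ↔
      V t ω ≤ quantileThreshold n ϑ t (history n V t ω) := by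
    refine (le_orderStat_iff _ hr hr' _).trans (Iff.trans ?_ (le_orderStat_iff _ hr hr' _).symm)
    have h1 : ∀ i : holdout n t, history n (fun i ω => F (V i ω)) t ω i < F (V t ω) ↔
        history n V t ω i < V t ω := fun i =>
      ⟨fun h => lt_of_not_ge fun h' => absurd (hF h') (not_le.2 h),
        fun h => lt_of_le_of_ne (hF h.le) (hne i)⟩
    rw [Nat.card_congr (Equiv.subtypeEquivRight h1)]
  unfold decision
  simp only [hiff]

theorem sum_range_inv_add_le_log {n : ℕ} (hn : 2 ≤ n) (T : ℕ) :
    ∑ j ∈ Finset.range T, 1 / ((j : ℝ) + n) ≤ Real.log ((T : ℝ) + n) := by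
  have hn' : (2 : ℝ) ≤ n := by exact_mod_cast hn
  -- The shift by one makes the induction telescope: 1/m ≤ log m − log (m − 1), which is log x ≤ x −
  -- 1 at x = (m − 1)/m.
  have h : ∑ j ∈ Finset.range T, 1 / ((j : ℝ) + n) ≤ Real.log ((T : ℝ) + n - 1) := by
    induction T with
    | zero => simpa using Real.log_nonneg (by linarith : (1 : ℝ) ≤ n - 1)
    | succ T ih =>
      rw [Finset.sum_range_succ]
      have hT : (0 : ℝ) ≤ T := Nat.cast_nonneg T
      have h1 : 0 < (T : ℝ) + n := by linarith
      have h2 : 0 < (T : ℝ) + n - 1 := by linarith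
      have h3 := Real.log_le_sub_one_of_pos (div_pos h2 h1)
      rw [Real.log_div h2.ne' h1.ne'] at h3
      have h4 : ((T : ℝ) + n - 1) / (T + n) - 1 = -(1 / (T + n)) := by
        field_simp
        ring
      have h5 : ((T + 1 : ℕ) : ℝ) + n - 1 = T + n := by push_cast; ring
      rw [h5]
      linarith
  refine h.trans (Real.log_le_log ?_ (by linarith))
  have hT : (0 : ℝ) ≤ T := Nat.cast_nonneg T
  linarith

/-! ### Uniform samples and empty grid cells -/

variable {Ω : Type*} [MeasurableSpace Ω] {μ : Measure Ω}

theorem densityBound_le_one {X : Ω → ℝ} (hX : μ.map X = volume.restrict (Set.Icc (0 : ℝ) 1)) :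
    densityBound μ X ≤ 1 := by
  have h : essSup (pdf X μ volume) volume ≤ 1 := by
    rw [pdf_def, hX]
    refine essSup_le_of_ae_le _ ?_
    filter_upwards [Measure.rnDeriv_restrict_self (volume : Measure ℝ)
      (measurableSet_Icc (a := (0 : ℝ)) (b := 1))] with x hx
    rw [hx]
    exact Set.indicator_le_self' (fun _ _ => zero_le_one) x
  exact ENNReal.toReal_mono ENNReal.one_ne_top h

theorem measureReal_forall_notMem_Ico [IsProbabilityMeasure μ] {ι : Type*} [Fintype ι]
    {Z : ι → Ω → ℝ} (hZ : ∀ i, Measurable (Z i)) (hind : iIndepFun Z μ)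
    (hlaw : ∀ i, μ.map (Z i) = volume.restrict (Set.Icc (0 : ℝ) 1)) {a b : ℝ} (ha : 0 ≤ a)
    (hab : a ≤ b) (hb : b ≤ 1) :
    μ.real {ω | ∀ i, Z i ω ∉ Set.Ico a b} = (1 - (b - a)) ^ Fintype.card ι := by
  have h1 : {ω | ∀ i, Z i ω ∉ Set.Ico a b} = ⋂ i ∈ Finset.univ, Z i ⁻¹' (Set.Ico a b)ᶜ := by
    ext ω; simp
  have h2 : ∀ i, μ (Z i ⁻¹' (Set.Ico a b)ᶜ) = ENNReal.ofReal (1 - (b - a)) := by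
    intro i
    have h3 : μ (Z i ⁻¹' Set.Ico a b) = ENNReal.ofReal (b - a) := by
      rw [← Measure.map_apply (hZ i) measurableSet_Ico, hlaw i,
        Measure.restrict_apply measurableSet_Ico, Set.inter_eq_left.2, Real.volume_Ico]
      exact fun y hy => ⟨ha.trans hy.1, hy.2.le.trans hb⟩
    rw [Set.preimage_compl, prob_compl_eq_one_sub (hZ i measurableSet_Ico), h3,
      ENNReal.ofReal_sub _ (sub_nonneg.2 hab), ENNReal.ofReal_one]
  rw [h1, measureReal_def, hind.measure_inter_preimage_eq_mul _
    (fun i _ => measurableSet_Ico.compl)]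
  simp only [h2, Finset.prod_const, Finset.card_univ, ENNReal.toReal_pow]
  rw [ENNReal.toReal_ofReal (by linarith)]

/-- Probability that some cell of the grid of mesh `h` of `[0,1]` misses all sample points. -/
theorem measureReal_exists_cell_empty_le [IsProbabilityMeasure μ] {ι : Type*} [Fintype ι]
    {Z : ι → Ω → ℝ} (hZ : ∀ i, Measurable (Z i)) (hind : iIndepFun Z μ)
    (hlaw : ∀ i, μ.map (Z i) = volume.restrict (Set.Icc (0 : ℝ) 1)) {h : ℝ} (hh : 0 < h) :
    μ.real {ω | ∃ j < ⌊1 / h⌋₊, ∀ i, Z i ω ∉ Set.Ico ((j : ℝ) * h) (((j : ℝ) + 1) * h)} ≤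
      1 / h * Real.exp (-(h * Fintype.card ι)) := by
  have h1 : {ω | ∃ j < ⌊1 / h⌋₊, ∀ i, Z i ω ∉ Set.Ico ((j : ℝ) * h) (((j : ℝ) + 1) * h)} =
      ⋃ j ∈ Finset.range ⌊1 / h⌋₊,
        {ω | ∀ i, Z i ω ∉ Set.Ico ((j : ℝ) * h) (((j : ℝ) + 1) * h)} := by
    ext ω; simp
  have hfl : (⌊1 / h⌋₊ : ℝ) ≤ 1 / h := Nat.floor_le (by positivity)
  rw [h1]
  refine (measureReal_biUnion_finset_le _ _).trans ?_
  calc _ ≤ ∑ j ∈ Finset.range ⌊1 / h⌋₊, Real.exp (-(h * Fintype.card ι)) := by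
        refine Finset.sum_le_sum fun j hj => ?_
        -- An index `j` in range forces (j + 1) h ≤ 1, so the cell lies in [0,1] and 1 − h ≥ 0; for
        -- h > 1 the sum is empty.
        have hj' : (j : ℝ) + 1 ≤ 1 / h :=
          le_trans (by exact_mod_cast Finset.mem_range.1 hj) hfl
        rw [le_div_iff₀ hh] at hj'
        have hj0 : (0 : ℝ) ≤ j * h := by positivity
        rw [measureReal_forall_notMem_Ico hZ hind hlaw hj0 (by nlinarith) hj']
        have e1 : 1 - (((j : ℝ) + 1) * h - j * h) = 1 - h := by ring
        have e2 : Real.exp (-(h * Fintype.card ι)) = Real.exp (-h) ^ Fintype.card ι := by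
          rw [← Real.exp_nat_mul]
          congr 1
          ring
        rw [e1, e2]
        exact pow_le_pow_left₀ (by nlinarith) (Real.one_sub_le_exp_neg h) _
    _ = ⌊1 / h⌋₊ * Real.exp (-(h * Fintype.card ι)) := by
        rw [Finset.sum_const, Finset.card_range, nsmul_eq_mul]
    _ ≤ _ := mul_le_mul_of_nonneg_right hfl (Real.exp_pos _).le

/-! ### Conditional swap sensitivity -/

/-- For scores in `[0,1]`, if every cell of the grid of mesh `h` contains a historical score, then
the swap sensitivity of the sample quantile is at most `3 h`. -/
theorem swapSensitivity_le [IsProbabilityMeasure μ] {n t : ℕ} (hn : 1 ≤ n) {ϑ : ℝ}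
    (hϑ : ϑ ∈ Set.Ioc (0 : ℝ) 1) {Z : ℤ → Ω → ℝ} {Z' : Ω → ℝ}
    (hZ : ∀ i ∈ holdout n t, Measurable (Z i)) (hZ' : Measurable Z')
    (hZI : ∀ i ω, Z i ω ∈ Set.Icc (0 : ℝ) 1) (hZI' : ∀ ω, Z' ω ∈ Set.Icc (0 : ℝ) 1)
    {h : ℝ} (hh : 0 < h) :
    ∀ᵐ ω ∂μ, (∀ j < ⌊1 / h⌋₊, ∃ i : holdout n t,
        Z i ω ∈ Set.Ico ((j : ℝ) * h) (((j : ℝ) + 1) * h)) →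
      swapSensitivity μ (quantileThreshold n ϑ) Z Z' t ω ≤ 3 * h := by
  classical
  have hcard : 1 ≤ Fintype.card (holdout n t) := by rw [card_holdout]; omega
  obtain ⟨hr, hr'⟩ := one_le_ceil_mul_card hϑ hcard
  have hne : Nonempty (holdout n t) := Fintype.card_pos_iff.1 hcard
  -- The bound must depend only on the scores other than `s`. Removing `s` may empty a cell, so the
  -- condition asks for a score in each pair of adjacent cells; when it fails, the trivial bound 1
  -- applies.
  have hs : ∀ s : holdout n t, ∀ᵐ ω ∂μ,
      (μ[fun ω' => |quantileThreshold n ϑ t (history n Z t ω') -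
        quantileThreshold n ϑ t (Function.update (history n Z t ω') s (Z' ω'))| |
        sigmaOthers Z t s]) ω ≤
      if ∀ j : ℕ, j + 1 < ⌊1 / h⌋₊ → ∃ i : {i : holdout n t // i ≠ s},
        Z i ω ∈ Set.Ico ((j : ℝ) * h) (((j : ℝ) + 2) * h) then 3 * h else 1 := by
    intro s
    set g : Ω → ℝ := fun ω => if ∀ j : ℕ, j + 1 < ⌊1 / h⌋₊ → ∃ i : {i : holdout n t // i ≠ s},
        Z i ω ∈ Set.Ico ((j : ℝ) * h) (((j : ℝ) + 2) * h) then 3 * h else 1 with hg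
    set f : Ω → ℝ := fun ω' => |quantileThreshold n ϑ t (history n Z t ω') -
        quantileThreshold n ϑ t (Function.update (history n Z t ω') s (Z' ω'))|
    have hm : sigmaOthers Z t s ≤ (inferInstance : MeasurableSpace Ω) :=
      iSup_le fun i => (hZ _ i.1.2).comap_le
    have hEm : MeasurableSet[sigmaOthers Z t s] {ω | ∀ j : ℕ, j + 1 < ⌊1 / h⌋₊ →
        ∃ i : {i : holdout n t // i ≠ s},
          Z i ω ∈ Set.Ico ((j : ℝ) * h) (((j : ℝ) + 2) * h)} := by
      have : {ω | ∀ j : ℕ, j + 1 < ⌊1 / h⌋₊ → ∃ i : {i : holdout n t // i ≠ s},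
          Z i ω ∈ Set.Ico ((j : ℝ) * h) (((j : ℝ) + 2) * h)} =
          ⋂ j : ℕ, ⋂ _ : j + 1 < ⌊1 / h⌋₊, ⋃ i : {i : holdout n t // i ≠ s},
            Z i ⁻¹' Set.Ico ((j : ℝ) * h) (((j : ℝ) + 2) * h) := by
        ext ω
        simp only [Set.mem_iInter, Set.mem_iUnion, Set.mem_preimage]
        rfl
      rw [this]
      refine MeasurableSet.iInter fun j => MeasurableSet.iInter fun _ =>
        MeasurableSet.iUnion fun i => ?_
      exact le_iSup (fun i : {i : holdout n t // i ≠ s} =>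
        MeasurableSpace.comap (Z i) inferInstance) i _ ⟨_, measurableSet_Ico, rfl⟩
    have hgm : StronglyMeasurable[sigmaOthers Z t s] g :=
      (Measurable.ite hEm measurable_const measurable_const).stronglyMeasurable
    have hgi : Integrable g μ := by
      refine Integrable.of_bound (hgm.mono hm).aestronglyMeasurable (3 * h + 1)
        (Filter.Eventually.of_forall fun ω => ?_)
      simp only [hg]
      split_ifs
      · rw [Real.norm_of_nonneg (by positivity)]; linarith
      · rw [norm_one]; linarith
    have hvm : Measurable (history n Z t) := measurable_pi_lambda _ fun i => hZ _ i.2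
    have hwm : Measurable fun ω => Function.update (history n Z t ω) s (Z' ω) := by
      refine measurable_pi_lambda _ fun i => ?_
      by_cases hi : i = s
      · subst hi; simpa using hZ'
      · simp only [Function.update_of_ne hi]
        exact hZ _ i.2
    have hvI : ∀ ω i, history n Z t ω i ∈ Set.Icc (0 : ℝ) 1 := fun ω i => hZI i ω
    have hwI : ∀ ω i, Function.update (history n Z t ω) s (Z' ω) i ∈ Set.Icc (0 : ℝ) 1 := by
      intro ω i
      by_cases hi : i = s
      · subst hi; simpa using hZI' ω
      · simp only [Function.update_of_ne hi]
        exact hZI i ω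
    have hfm : Measurable f :=
      (((measurable_orderStat hr hr').comp hvm).sub ((measurable_orderStat hr hr').comp hwm)).abs
    have hf1 : ∀ ω, f ω ≤ 1 := fun ω => by
      have h1 := orderStat_mem_Icc hr hr' (hvI ω)
      have h2 := orderStat_mem_Icc hr hr' (hwI ω)
      exact abs_sub_le_of_nonneg_of_le h1.1 h1.2 h2.1 h2.2
    have hfi : Integrable f μ := by
      refine Integrable.of_bound hfm.aestronglyMeasurable 1
        (Filter.Eventually.of_forall fun ω => ?_)
      rw [Real.norm_of_nonneg (abs_nonneg _)]
      exact hf1 ω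
    have hfg : f ≤ g := by
      intro ω
      simp only [hg]
      split_ifs with hE
      · refine abs_orderStat_sub_le hr hr' (s := s)
          (fun i hi => (Function.update_of_ne hi _ _).symm) (hvI ω) (hwI ω) hh fun j hj => ?_
        obtain ⟨i, hi⟩ := hE j hj
        exact ⟨i.1, i.2, hi⟩
      · exact hf1 ω
    -- `g` is measurable for the conditioning σ-algebra, so it is its own conditional expectation.
    have := condExp_mono (m := sigmaOthers Z t s) hfi hgi (Filter.Eventually.of_forall hfg)
    rwa [condExp_of_stronglyMeasurable hm hgm hgi] at this
  filter_upwards [ae_all_iff.2 hs] with ω hω hcell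
  refine ciSup_le fun s => (hω s).trans (le_of_eq (if_pos fun j hj => ?_))
  -- Disjoint neighbouring cells hold scores with different indices, at most one of which is `s`.
  obtain ⟨i, hi⟩ := hcell j (by omega)
  obtain ⟨k, hk⟩ := hcell (j + 1) hj
  push_cast at hk
  by_cases his : i = s
  · refine ⟨⟨k, ?_⟩, ?_, ?_⟩
    · rintro rfl
      subst his
      linarith [hi.2, hk.1]
    · nlinarith [hk.1]
    · linarith [hk.2]
  · exact ⟨⟨i, his⟩, hi.1, by nlinarith [hi.2]⟩

/-- By Fubini the diagonal is null for a product measure with an atomless factor. -/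
theorem ae_ne_of_indepFun [IsProbabilityMeasure μ] {X Y : Ω → ℝ} (hX : Measurable X)
    (hY : Measurable Y) (hXY : IndepFun X Y μ)
    (hlaw : μ.map Y = volume.restrict (Set.Icc (0 : ℝ) 1)) : ∀ᵐ ω ∂μ, X ω ≠ Y ω := by
  have h1 := (indepFun_iff_map_prod_eq_prod_map_map hX.aemeasurable hY.aemeasurable).1 hXY
  have hD : MeasurableSet {p : ℝ × ℝ | p.1 = p.2} :=
    measurableSet_eq_fun measurable_fst measurable_snd
  have h2 : ((μ.map X).prod (μ.map Y)) {p : ℝ × ℝ | p.1 = p.2} = 0 := by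
    rw [hlaw, Measure.measure_prod_null hD]
    refine Filter.Eventually.of_forall fun x => ?_
    have h3 : Prod.mk x ⁻¹' {p : ℝ × ℝ | p.1 = p.2} = {x} := by
      ext y
      exact eq_comm
    simp only [h3, Pi.zero_apply, measure_singleton]
  rw [← h1, Measure.map_apply (hX.prodMk hY) hD] at h2
  rw [ae_iff]
  refine measure_mono_null (fun ω hω => ?_) h2
  exact not_not.1 hω

/-- For i.i.d. uniform scores, with high probability every cell of the grid of mesh
`4 log (T + n) / (t + n)` contains a historical score, at all times `t < T`. -/
theorem measureReal_exists_grid_empty_le [IsProbabilityMeasure μ] {n T : ℕ} (hn : 3 ≤ n)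
    {Z : ℤ → Ω → ℝ} (hZ : ∀ i ∈ Finset.Icc (-(n : ℤ)) (T : ℤ), Measurable (Z i))
    (hind : iIndepFun (fun i : Finset.Icc (-(n : ℤ)) (T : ℤ) => Z i) μ)
    (hlaw : ∀ i ∈ Finset.Icc (-(n : ℤ)) (T : ℤ),
      μ.map (Z i) = volume.restrict (Set.Icc (0 : ℝ) 1)) {h : ℕ → ℝ}
    (hh : ∀ t, h t = 4 * Real.log ((T : ℝ) + n) / ((t : ℝ) + n)) :
    μ.real {ω | ∃ t < T, ∃ j < ⌊1 / h t⌋₊, ∀ i : holdout n t,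
      Z i ω ∉ Set.Ico ((j : ℝ) * h t) (((j : ℝ) + 1) * h t)} ≤ (((T : ℝ) + n) ^ 2)⁻¹ := by
  have hn' : (3 : ℝ) ≤ n := by exact_mod_cast hn
  have hT : (0 : ℝ) ≤ T := Nat.cast_nonneg T
  set N : ℝ := (T : ℝ) + n with hN
  have hN0 : 0 < N := by linarith
  have hL : 1 ≤ Real.log N := by
    rw [Real.le_log_iff_exp_le hN0]
    linarith [Real.exp_one_lt_three]
  have h1 : {ω | ∃ t < T, ∃ j < ⌊1 / h t⌋₊, ∀ i : holdout n t,
      Z i ω ∉ Set.Ico ((j : ℝ) * h t) (((j : ℝ) + 1) * h t)} =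
      ⋃ t ∈ Finset.range T, {ω | ∃ j < ⌊1 / h t⌋₊, ∀ i : holdout n t,
        Z i ω ∉ Set.Ico ((j : ℝ) * h t) (((j : ℝ) + 1) * h t)} := by
    ext ω; simp
  rw [h1]
  refine (measureReal_biUnion_finset_le _ _).trans ?_
  have h2 : ∀ t ∈ Finset.range T, μ.real {ω | ∃ j < ⌊1 / h t⌋₊, ∀ i : holdout n t,
      Z i ω ∉ Set.Ico ((j : ℝ) * h t) (((j : ℝ) + 1) * h t)} ≤ N * (N ^ 4)⁻¹ := by
    intro t ht
    have htT : (t : ℝ) ≤ T := by exact_mod_cast (Finset.mem_range.1 ht).le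
    have hm0 : 0 < (t : ℝ) + n := by positivity
    have hht : 0 < h t := by rw [hh]; positivity
    have hsub : ∀ i : holdout n t, i.1 ∈ Finset.Icc (-(n : ℤ)) (T : ℤ) := fun i => by
      have h3 := Finset.mem_Ico.1 i.2
      have h4 := Finset.mem_range.1 ht
      rw [Finset.mem_Icc]
      omega
    have hind' : iIndepFun (fun i : holdout n t => Z i) μ :=
      hind.precomp (g := fun i : holdout n t => ⟨i.1, hsub i⟩)
        fun i j hij => Subtype.ext (by simpa using hij)
    refine (measureReal_exists_cell_empty_le (fun i => hZ _ (hsub i)) hind'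
      (fun i => hlaw _ (hsub i)) hht).trans ?_
    have h5 : h t * (Fintype.card (holdout n t) : ℝ) = 4 * Real.log N := by
      -- The constant 4 yields failure probability N⁻⁴ per cell; at most N cells and at most N times
      -- leave N⁻².
      rw [card_holdout, hh]
      push_cast
      field_simp
    have h6 : Real.exp (-(4 * Real.log N)) = (N ^ 4)⁻¹ := by
      rw [Real.exp_neg, ← Real.exp_log (pow_pos hN0 4), Real.log_pow]
      norm_num
    rw [h5, h6]
    refine mul_le_mul_of_nonneg_right ?_ (by positivity)
    rw [hh, one_div_div, div_le_iff₀ (by positivity)]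
    nlinarith
  refine (Finset.sum_le_sum h2).trans ?_
  rw [Finset.sum_const, Finset.card_range, nsmul_eq_mul]
  calc (T : ℝ) * (N * (N ^ 4)⁻¹) ≤ N * (N * (N ^ 4)⁻¹) :=
        mul_le_mul_of_nonneg_right (by linarith) (by positivity)
    _ = (N ^ 2)⁻¹ := by field_simp

/-- With L = log (T + n) ≥ 1, the sensitivities contribute at most 2 · 12 L², and the rest is at
most 9 L + 1/2 ≤ 12 L². -/
theorem errorTerm_le {n T : ℕ} (hn : 3 ≤ n) {A : Threshold n} {Z : ℤ → Ω → ℝ} {Z' : Ω → ℝ}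
    (hρ : densityBound μ (Z 0) ≤ 1) {ω : Ω}
    (hσ : ∀ t < T, swapSensitivity μ A Z Z' t ω ≤
      3 * (4 * Real.log ((T : ℝ) + n) / ((t : ℝ) + n))) :
    errorTerm μ A Z Z' T ω ≤ 36 * Real.log ((T : ℝ) + n) ^ 2 := by
  have hn' : (3 : ℝ) ≤ n := by exact_mod_cast hn
  have hT : (0 : ℝ) ≤ T := Nat.cast_nonneg T
  have hsum := sum_range_inv_add_le_log (show 2 ≤ n by omega) T
  have hL : 1 ≤ Real.log ((T : ℝ) + n) := by
    rw [Real.le_log_iff_exp_le (by linarith)]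
    linarith [Real.exp_one_lt_three]
  unfold errorTerm
  set N : ℝ := Real.log ((T : ℝ) + n) with hN
  have h1 : ∑ j ∈ Finset.range T, swapSensitivity μ A Z Z' j ω ≤ 12 * N * N :=
    calc _ ≤ ∑ j ∈ Finset.range T, 12 * N * (1 / ((j : ℝ) + n)) :=
          Finset.sum_le_sum fun j hj => (hσ j (Finset.mem_range.1 hj)).trans (le_of_eq (by ring))
      _ = 12 * N * ∑ j ∈ Finset.range T, 1 / ((j : ℝ) + n) := (Finset.mul_sum _ _ _).symm
      _ ≤ _ := mul_le_mul_of_nonneg_left hsum (by positivity)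
  have h2 : √(Real.exp 1 * densityBound μ (Z 0)) ≤ 2 := by
    refine Real.sqrt_le_iff.2 ⟨by norm_num, ?_⟩
    nlinarith [Real.exp_one_lt_three, Real.exp_pos 1]
  nlinarith

end CAP

/-! ### Assembly of the two claims -/

theorem mainTheorem10 {Ω : Type*} [MeasurableSpace Ω] (μ : Measure Ω) [IsProbabilityMeasure μ]
    (n T : ℕ) (hn : 9 ≤ n) (ϑ : ℝ) (hϑ : ϑ ∈ Set.Ioc (0 : ℝ) 1)
    -- i.i.d. scores `V_{-n}, …, V_T` with a common law `ν` whose c.d.f. is continuous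
    (V : ℤ → Ω → ℝ) (ν : Measure ℝ) [IsProbabilityMeasure ν]
    (hmeas : ∀ i ∈ Finset.Icc (-(n : ℤ)) (T : ℤ), Measurable (V i))
    (hlaw : ∀ i ∈ Finset.Icc (-(n : ℤ)) (T : ℤ), μ.map (V i) = ν)
    (hindep : iIndepFun (fun i : Finset.Icc (-(n : ℤ)) (T : ℤ) => V i) μ)
    (hcont : Continuous (cdf ν))
    -- an independent copy `V'` of the scores
    (V' : Ω → ℝ) (hmeas' : Measurable V') (hlaw' : μ.map V' = ν)
    (hindep' : IndepFun V' (fun ω (i : Finset.Icc (-(n : ℤ)) (T : ℤ)) => V i ω) μ) :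
    -- the normalised scores `F(V_i)` lead to the same selection decisions as the scores `V_i`
    (∀ᵐ ω ∂μ, ∀ t ≤ T,
      CAP.decision (CAP.quantileThreshold n ϑ) (fun i ω => cdf ν (V i ω)) t ω =
        CAP.decision (CAP.quantileThreshold n ϑ) V t ω) ∧
    -- the error of the normalised scores is at most `36 log² (T + n)` with high probability
    1 - (((T : ℝ) + (n : ℝ)) ^ 2)⁻¹ ≤
      μ.real {ω | CAP.errorTerm μ (CAP.quantileThreshold n ϑ) (fun i ω => cdf ν (V i ω))
          (fun ω => cdf ν (V' ω)) T ω ≤ 36 * Real.log ((T : ℝ) + (n : ℝ)) ^ 2} := by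
  have hZ : ∀ i ∈ Finset.Icc (-(n : ℤ)) (T : ℤ), Measurable fun ω => cdf ν (V i ω) :=
    fun i hi => hcont.measurable.comp (hmeas i hi)
  have hZlaw : ∀ i ∈ Finset.Icc (-(n : ℤ)) (T : ℤ),
      μ.map (fun ω => cdf ν (V i ω)) = volume.restrict (Set.Icc (0 : ℝ) 1) := fun i hi => by
    rw [← CAP.map_cdf_eq_restrict ν hcont, ← hlaw i hi,
      Measure.map_map (hlaw i hi ▸ hcont.measurable) (hmeas i hi)]
    rfl
  have hZind : iIndepFun
      (fun (i : Finset.Icc (-(n : ℤ)) (T : ℤ)) ω => cdf ν (V i ω)) μ :=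
    hindep.comp (fun _ => cdf ν) fun _ => hcont.measurable
  have hI : ∀ x, cdf ν x ∈ Set.Icc (0 : ℝ) 1 := fun x => ⟨cdf_nonneg ν x, cdf_le_one ν x⟩
  constructor
  · have hne : ∀ i j : Finset.Icc (-(n : ℤ)) (T : ℤ), i ≠ j →
        ∀ᵐ ω ∂μ, cdf ν (V i ω) ≠ cdf ν (V j ω) := fun i j hij =>
      CAP.ae_ne_of_indepFun (hZ i i.2) (hZ j j.2) (hZind.indepFun hij) (hZlaw j j.2)
    have hall : ∀ᵐ ω ∂μ, ∀ i j : Finset.Icc (-(n : ℤ)) (T : ℤ), i ≠ j →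
        cdf ν (V i ω) ≠ cdf ν (V j ω) := by
      simpa only [ae_all_iff] using hne
    filter_upwards [hall] with ω hω t ht
    refine CAP.decision_comp_eq (by omega) hϑ (monotone_cdf ν) fun i => ?_
    have hi := Finset.mem_Ico.1 i.2
    exact hω ⟨i, Finset.mem_Icc.2 (by omega)⟩ ⟨t, Finset.mem_Icc.2 (by omega)⟩
      fun h => by simp only [Subtype.mk.injEq] at h; omega
  · have hT : (0 : ℝ) ≤ T := Nat.cast_nonneg T
    have hn' : (9 : ℝ) ≤ n := by exact_mod_cast hn
    have hL : 0 < Real.log ((T : ℝ) + n) := Real.log_pos (by linarith)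
    obtain ⟨h, hh⟩ : ∃ h : ℕ → ℝ, ∀ t, h t = 4 * Real.log ((T : ℝ) + n) / ((t : ℝ) + n) :=
      ⟨_, fun _ => rfl⟩
    have hbad := CAP.measureReal_exists_grid_empty_le (by omega) hZ hZind hZlaw hh
    set B : Set Ω := {ω | ∃ t < T, ∃ j < ⌊1 / h t⌋₊, ∀ i : CAP.holdout n t,
      cdf ν (V i ω) ∉ Set.Ico ((j : ℝ) * h t) (((j : ℝ) + 1) * h t)}
    have hσ : ∀ᵐ ω ∂μ, ∀ t, t < T → (∀ j < ⌊1 / h t⌋₊, ∃ i : CAP.holdout n t,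
        cdf ν (V i ω) ∈ Set.Ico ((j : ℝ) * h t) (((j : ℝ) + 1) * h t)) →
        CAP.swapSensitivity μ (CAP.quantileThreshold n ϑ) (fun i ω => cdf ν (V i ω))
          (fun ω => cdf ν (V' ω)) t ω ≤ 3 * h t := by
      refine ae_all_iff.2 fun t => ?_
      by_cases ht : t < T
      · have hht : 0 < h t := by rw [hh]; positivity
        have hZt : ∀ i ∈ CAP.holdout n t, Measurable fun ω => cdf ν (V i ω) := fun i hi => by
          have := Finset.mem_Ico.1 hi
          exact hZ i (Finset.mem_Icc.2 (by omega))
        have hV' : Measurable fun ω => cdf ν (V' ω) := hcont.measurable.comp hmeas'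
        have hle := CAP.swapSensitivity_le (μ := μ) (by omega) hϑ hZt hV'
          (fun _ _ => hI _) (fun _ => hI _) hht
        exact hle.mono fun ω hω _ => hω
      · exact Filter.Eventually.of_forall fun _ h' => absurd h' ht
    have hρ := CAP.densityBound_le_one (hZlaw 0 (Finset.mem_Icc.2 (by omega)))
    -- Almost every outcome is in the bad event `B` or satisfies the error bound; subadditivity then
    -- needs no measurability of either set.
    have hsub : (Set.univ : Set Ω) ≤ᵐ[μ] (B ∪ {ω | CAP.errorTerm μ (CAP.quantileThreshold n ϑ)
        (fun i ω => cdf ν (V i ω)) (fun ω => cdf ν (V' ω)) T ω ≤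
          36 * Real.log ((T : ℝ) + (n : ℝ)) ^ 2} : Set Ω) := by
      filter_upwards [hσ] with ω hω _
      by_cases hωB : ω ∈ B
      · exact Or.inl hωB
      · have hgrid : ∀ t < T, ∀ j < ⌊1 / h t⌋₊, ∃ i : CAP.holdout n t,
            cdf ν (V i ω) ∈ Set.Ico ((j : ℝ) * h t) (((j : ℝ) + 1) * h t) := by
          intro t ht j hj
          by_contra! hno
          exact hωB ⟨t, ht, j, hj, hno⟩
        refine Or.inr (CAP.errorTerm_le (A := CAP.quantileThreshold n ϑ)
          (Z := fun i ω => cdf ν (V i ω)) (Z' := fun ω => cdf ν (V' ω)) (by omega) hρ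
          fun t ht => ?_)
        rw [← hh t]
        exact hω t ht (hgrid t ht)
    have h1 := ENNReal.toReal_mono (measure_ne_top μ _) (measure_mono_ae hsub)
    rw [measure_univ, ENNReal.toReal_one] at h1
    have h2 := h1.trans (measureReal_union_le _ _)
    linarith
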